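/- Let $N\ge 0$ be an integer and let $\mathbf X=(X_1,\dots,X_N)$ be an $N$-dimensional Gaussian random vector (its covariance matrix may be singular) with mean vector $\boldsymbol\mu=(\mu_1,\dots,\mu_N)$, $\mu_i=\mathbb E[X_i]$, and covariance matrix $C=(C_{ij})$, $C_{ij}=\operatorname{Cov}(X_i,X_j)$. Let $\mathbf n=(n_1,\dots,n_N)$ be a vector of nonnegative integers. For an $N\times N$ matrix $\mathbf m=(m_{ij})$ of nonnegative integers put $$r_i=r_i(\mathbf n,\mathbf m)=n_i-\sum_{j=1}^N(1+\delta_{ij})\,m_{ij},\qquad i=1,\dots,N,$$ where $\delta_{ij}$ is the Kronecker delta, and let $S_{\mathbf n}$ be the (finite) set of all symmetric $N\times N$ matrices $\mathbf m$ of nonnegative integers such that $r_i\ge 0$ for all $i=1,\dots,N$. Then $\prod_{i=1}^N X_i^{n_i}$ is integrable and $$\mathbb E\left[\prod_{i=1}^N X_i^{n_i}\right]=\sum_{\mathbf m\in S_{\mathbf n}} d_{\mathbf n,\mathbf m}\left(\prod_{i=1}^N\prod_{j=i}^N C_{ij}^{\,m_{ij}}\right)\left(\prod_{i=1}^N\mu_i^{\,r_i}\right),$$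 where $$d_{\mathbf n,\mathbf m}=\frac{\prod_{i=1}^N n_i!}{2^{\sum_{i=1}^N m_{ii}}\left(\prod_{i=1}^N\prod_{j=i}^N m_{ij}!\right)\left(\prod_{i=1}^N r_i!\right)},$$ with the convention $0^0=1$. -/

import Mathlib

open MeasureTheory ProbabilityTheory

namespace GaussianMoments

/-- The integer `r_i = n_i - ∑_j (1 + δ_ij) m_ij` (no truncated subtraction). -/
def r {N : ℕ} (n : Fin N → ℕ) (m : Matrix (Fin N) (Fin N) ℕ) (i : Fin N) : ℤ :=
  (n i : ℤ) - ∑ j, (1 + (if i = j then 1 else 0)) * (m i j : ℤ)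

/-- The symmetric matrices `m` of nonnegative integers for which every `r_i` is nonnegative. -/
def S {N : ℕ} (n : Fin N → ℕ) : Set (Matrix (Fin N) (Fin N) ℕ) :=
  {m | m.IsSymm ∧ ∀ i, 0 ≤ r n m i}

theorem S_finite {N : ℕ} (n : Fin N → ℕ) : (S n).Finite := by
  have hfin : (Set.pi Set.univ fun i : Fin N =>
      Set.pi Set.univ fun _ : Fin N => Set.Iic (n i)).Finite :=
    Set.Finite.pi fun i => Set.Finite.pi fun _ => Set.finite_Iic (n i)
  refine hfin.subset ?_
  rintro m ⟨-, hm⟩ i - j -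
  have h1 : (m i j : ℤ) ≤ (1 + (if i = j then 1 else 0)) * (m i j : ℤ) := by
    split_ifs <;> omega
  have h2 : (1 + (if i = j then 1 else 0)) * (m i j : ℤ)
      ≤ ∑ k, (1 + (if i = k then 1 else 0)) * (m i k : ℤ) :=
    Finset.single_le_sum (f := fun k => (1 + (if i = k then 1 else 0)) * (m i k : ℤ))
      (fun k _ => by positivity) (Finset.mem_univ j)
  have h3 := hm i
  unfold r at h3
  have h4 : (m i j : ℤ) ≤ (n i : ℤ) := by linarith
  exact_mod_cast h4

/-- The coefficient
`d_{n,m} = ∏ n_i! / (2 ^ (∑ m_ii) * ∏_{i ≤ j} m_ij! * ∏ r_i!)`, as a real number.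
It is used for `m ∈ S n` only, where `(r n m i).toNat` is `r n m i` itself. -/
noncomputable def d {N : ℕ} (n : Fin N → ℕ) (m : Matrix (Fin N) (Fin N) ℕ) : ℝ :=
  (∏ i, ((n i).factorial : ℝ)) /
    ((2 : ℝ) ^ (∑ i, m i i) * (∏ i, ∏ j ∈ Finset.Ici i, ((m i j).factorial : ℝ)) *
      ∏ i, ((r n m i).toNat.factorial : ℝ))

end GaussianMoments

/-! For real `t`, the variable `∑ t_i X_i` is Gaussian on the line, with mean `∑ t_i μ_i` and
variance `∑ C_ij t_i t_j`. Its `p`-th moment over `p!` is therefore the coefficient of `u ^ p` in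
`exp (u * ∑ t_i μ_i + u ^ 2 * ∑_{i ≤ j} q_ij t_i t_j)`, where `q_ij = C_ij` off the diagonal and
`q_ii = C_ii / 2` (`integral_pow_of_hasGaussianLaw`). No density is used, so a singular `C` needs no
separate treatment.

Expanding the moment by the multinomial theorem makes it a polynomial in `t` with coefficients `E[∏
X_i ^ k_i] / ∏ k_i!` (`sum_moments_eq_expQuadCoeff`). Comparing coefficients of `t ^ n`, with `p = ∑
n_i`, isolates the wanted moment (`coeff_eq_sum_S`). On the other side the surviving exponents of
the `q_ij` form the upper half of a symmetric matrix `m`, and those of the `μ_i` are then forced to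
be `r_i` (`sum_totalDegree_eq_sum_S`). -/

namespace GaussianMoments

/-! ### Moments of a real Gaussian variable -/

/-- The pairs `(a, b)` of natural numbers with `a + 2 * b = p`. -/
def weightedPairs (p : ℕ) : Finset (ℕ × ℕ) :=
  (Finset.range (p + 1) ×ˢ Finset.range (p + 1)).filter fun x => x.1 + 2 * x.2 = p

theorem mem_weightedPairs {p : ℕ} {x : ℕ × ℕ} : x ∈ weightedPairs p ↔ x.1 + 2 * x.2 = p := by
  simp only [weightedPairs, Finset.mem_filter, Finset.mem_product, Finset.mem_range]
  omega

theorem sum_weightedPairs_eq {p K L : ℕ} (hK : p < K) (hL : p < L) (F : ℕ → ℕ → ℝ) :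
    ∑ x ∈ weightedPairs p, F x.1 x.2 =
      ∑ a ∈ Finset.range K, ∑ b ∈ Finset.range L, if a + 2 * b = p then F a b else 0 := by
  rw [← Finset.sum_product', ← Finset.sum_filter]
  refine Finset.sum_congr ?_ fun _ _ => rfl
  ext x
  simp only [mem_weightedPairs, Finset.mem_filter, Finset.mem_product, Finset.mem_range]
  omega

/-- The coefficient of `t ^ p` in `exp (m * t + w * t ^ 2)`. -/
noncomputable def expQuadCoeff (m w : ℝ) (p : ℕ) : ℝ :=
  ∑ x ∈ weightedPairs p, (m ^ x.1 / (x.1.factorial : ℝ)) * (w ^ x.2 / (x.2.factorial : ℝ))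

theorem succ_mul_pow_succ_div_factorial (m : ℝ) (a : ℕ) :
    ((a + 1 : ℕ) : ℝ) * (m ^ (a + 1) / ((a + 1).factorial : ℝ)) =
      m * (m ^ a / (a.factorial : ℝ)) := by
  rw [Nat.factorial_succ]
  have : (a.factorial : ℝ) ≠ 0 := by positivity
  rw [pow_succ]
  push_cast
  field_simp

/-- This is `f' = (m + 2 * w * t) * f` read on coefficients. Writing `p + 2 = a + 2 * b` splits the
sum in two; each factor `a` or `b` cancels into a factorial and lowers that index by one. -/
theorem expQuadCoeff_rec (m w : ℝ) (p : ℕ) :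
    ((p + 2 : ℕ) : ℝ) * expQuadCoeff m w (p + 2) =
      m * expQuadCoeff m w (p + 1) + 2 * w * expQuadCoeff m w p := by
  have h : ((p + 2 : ℕ) : ℝ) * expQuadCoeff m w (p + 2) =
      ∑ x ∈ weightedPairs (p + 2),
        ((x.1 : ℝ) * (m ^ x.1 / (x.1.factorial : ℝ))) * (w ^ x.2 / (x.2.factorial : ℝ)) +
      ∑ x ∈ weightedPairs (p + 2),
        (m ^ x.1 / (x.1.factorial : ℝ)) * (2 * ((x.2 : ℝ) * (w ^ x.2 / (x.2.factorial : ℝ)))) := by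
    rw [expQuadCoeff, Finset.mul_sum, ← Finset.sum_add_distrib]
    refine Finset.sum_congr rfl fun x hx => ?_
    rw [← mem_weightedPairs.1 hx]
    push_cast
    ring
  rw [h]
  congr 1
  -- The range of `a` has one spare element: its term `a = 0` vanishes, and the shift leaves the
  -- range `p + 3`.
  · rw [sum_weightedPairs_eq (K := p + 3 + 1) (L := p + 3) (by omega) (by omega)
        (fun a b => ((a : ℝ) * (m ^ a / (a.factorial : ℝ))) * (w ^ b / (b.factorial : ℝ))),
      Finset.sum_range_succ', expQuadCoeff,
      sum_weightedPairs_eq (K := p + 3) (L := p + 3) (by omega) (by omega)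
        (fun a b => (m ^ a / (a.factorial : ℝ)) * (w ^ b / (b.factorial : ℝ)))]
    simp only [succ_mul_pow_succ_div_factorial, Nat.cast_zero, zero_mul, ite_self,
      Finset.sum_const_zero, add_zero, Finset.mul_sum]
    refine Finset.sum_congr rfl fun a _ => Finset.sum_congr rfl fun b _ => ?_
    rw [mul_ite, mul_zero, ← mul_assoc]
    exact if_congr (by omega) rfl rfl
  · rw [sum_weightedPairs_eq (K := p + 3) (L := p + 3 + 1) (by omega) (by omega)
        (fun a b => (m ^ a / (a.factorial : ℝ)) * (2 * ((b : ℝ) * (w ^ b / (b.factorial : ℝ))))),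
      expQuadCoeff,
      sum_weightedPairs_eq (K := p + 3) (L := p + 3) (by omega) (by omega)
        (fun a b => (m ^ a / (a.factorial : ℝ)) * (w ^ b / (b.factorial : ℝ))), Finset.mul_sum]
    refine Finset.sum_congr rfl fun a _ => ?_
    rw [Finset.sum_range_succ']
    simp only [succ_mul_pow_succ_div_factorial, Nat.cast_zero, zero_mul, mul_zero, ite_self,
      add_zero, Finset.mul_sum]
    refine Finset.sum_congr rfl fun b _ => ?_
    rw [mul_ite, mul_zero]
    exact if_congr (by omega) (by ring) rfl

theorem expQuadCoeff_zero (m w : ℝ) : expQuadCoeff m w 0 = 1 := by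
  have : weightedPairs 0 = {(0, 0)} := by decide
  simp [expQuadCoeff, this]

theorem expQuadCoeff_one (m w : ℝ) : expQuadCoeff m w 1 = m := by
  have : weightedPairs 1 = {(1, 0)} := by decide
  simp [expQuadCoeff, this]

theorem iteratedDeriv_rec_of_deriv_eq {f : ℝ → ℝ} (hf : ContDiff ℝ ⊤ f) (m v : ℝ)
    (h : ∀ t, deriv f t = (m + v * t) * f t) (p : ℕ) (t : ℝ) :
    iteratedDeriv (p + 2) f t =
      (m + v * t) * iteratedDeriv (p + 1) f t + (p + 1) * v * iteratedDeriv p f t := by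
  have hd (k : ℕ) : Differentiable ℝ (iteratedDeriv k f) :=
    hf.differentiable_iteratedDeriv k (WithTop.coe_lt_top _)
  have hlin (t : ℝ) : HasDerivAt (fun t => m + v * t) v t := by
    simpa using ((hasDerivAt_id t).const_mul v).const_add m
  induction p generalizing t with
  | zero =>
    have h1 : iteratedDeriv 1 f = fun t => (m + v * t) * f t := by
      rw [iteratedDeriv_one]; exact funext h
    rw [iteratedDeriv_succ, zero_add, h1]
    have h0 : HasDerivAt f (deriv f t) t := by
      have := (hd 0 t).hasDerivAt; rwa [iteratedDeriv_zero] at this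
    rw [((hlin t).fun_mul h0).deriv, h t]
    simp
    ring
  | succ p ih =>
    rw [iteratedDeriv_succ, funext ih]
    have h1 : HasDerivAt (iteratedDeriv (p + 1) f) (iteratedDeriv (p + 2) f t) t := by
      rw [iteratedDeriv_succ (n := p + 1)]; exact (hd _ t).hasDerivAt
    have h0 : HasDerivAt (iteratedDeriv p f) (iteratedDeriv (p + 1) f t) t := by
      rw [iteratedDeriv_succ (n := p)]; exact (hd _ t).hasDerivAt
    rw [(((hlin t).fun_mul h1).fun_add (h0.const_mul _)).deriv, ih t]
    push_cast
    ring

/-- Both sides obey the same two-step recurrence with the same first two values. -/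
theorem iteratedDeriv_exp_quad_zero (m v : ℝ) (p : ℕ) :
    iteratedDeriv p (fun t => Real.exp (m * t + v * t ^ 2 / 2)) 0 =
      p.factorial * expQuadCoeff m (v / 2) p := by
  have hf : ContDiff ℝ ⊤ (fun t : ℝ => Real.exp (m * t + v * t ^ 2 / 2)) := by fun_prop
  have h (t : ℝ) : deriv (fun t : ℝ => Real.exp (m * t + v * t ^ 2 / 2)) t =
      (m + v * t) * Real.exp (m * t + v * t ^ 2 / 2) := by
    have h1 : HasDerivAt (fun t : ℝ => m * t + v * t ^ 2 / 2) (m + v * t) t := by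
      have := ((hasDerivAt_id t).const_mul m).fun_add
        (((hasDerivAt_pow 2 t).const_mul v).div_const 2)
      convert! this using 1
      simp
      ring
    rw [h1.exp.deriv, mul_comm]
  induction p using Nat.twoStepInduction with
  | zero => simp [expQuadCoeff_zero]
  | one => simp [expQuadCoeff_one, iteratedDeriv_one, h]
  | more p ih0 ih1 =>
    rw [iteratedDeriv_rec_of_deriv_eq hf m v h, ih0, ih1]
    have hrec := expQuadCoeff_rec m (v / 2) p
    simp only [Nat.factorial_succ]
    push_cast at hrec ⊢
    linear_combination (-((p : ℝ) + 1) * p.factorial) * hrec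

theorem integral_pow_gaussianReal (m : ℝ) (v : NNReal) (p : ℕ) :
    ∫ x, x ^ p ∂gaussianReal m v = p.factorial * expQuadCoeff m (v / 2) p := by
  rw [← iteratedDeriv_exp_quad_zero, ← mgf_id_gaussianReal, iteratedDeriv_mgf_zero (by simp)]
  rfl

theorem integral_pow_of_hasGaussianLaw {Ω : Type*} [MeasurableSpace Ω] {P : Measure Ω}
    {Y : Ω → ℝ} (hY : HasGaussianLaw Y P) (p : ℕ) :
    ∫ ω, Y ω ^ p ∂P = p.factorial * expQuadCoeff (∫ ω, Y ω ∂P) (Var[Y; P] / 2) p := by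
  have h := integral_pow_gaussianReal (∫ ω, Y ω ∂P) Var[Y; P].toNNReal p
  rw [← hY.map_eq_gaussianReal, integral_map hY.aemeasurable (by fun_prop),
    Real.coe_toNNReal _ (variance_nonneg _ _)] at h
  exact h

/-! ### Exponents and symmetric matrices -/

/-- The pairs `(i, j)` with `i ≤ j`. -/
def upperPairs (N : ℕ) : Finset (Fin N × Fin N) :=
  Finset.univ.filter fun e => e.1 ≤ e.2

theorem mem_upperPairs {N : ℕ} {e : Fin N × Fin N} : e ∈ upperPairs N ↔ e.1 ≤ e.2 := by
  simp [upperPairs]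

theorem prod_upperPairs {N : ℕ} {M : Type*} [CommMonoid M] (F : Fin N × Fin N → M) :
    ∏ e ∈ upperPairs N, F e = ∏ i, ∏ j ∈ Finset.Ici i, F (i, j) := by
  rw [upperPairs, Finset.prod_filter, Fintype.prod_prod_type]
  refine Finset.prod_congr rfl fun i _ => ?_
  rw [← Finset.prod_filter]
  refine Finset.prod_congr ?_ fun _ _ => rfl
  ext j
  simp

theorem sum_upperPairs {N : ℕ} {M : Type*} [AddCommMonoid M] (F : Fin N × Fin N → M) :
    ∑ e ∈ upperPairs N, F e = ∑ i, ∑ j, if i ≤ j then F (i, j) else 0 := by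
  rw [upperPairs, Finset.sum_filter, Fintype.sum_prod_type]

/-- The exponent of `t` in `∏ i, t i ^ r i * ∏ i ≤ j, (t i * t j) ^ k (i, j)`. -/
noncomputable def totalDegree {N : ℕ} (r : Fin N → ℕ) (k : Fin N × Fin N → ℕ) : Fin N →₀ ℕ :=
  Finsupp.equivFunOnFinite.symm fun i =>
    r i + ∑ e ∈ upperPairs N, k e * ((if e.1 = i then 1 else 0) + (if e.2 = i then 1 else 0))

theorem totalDegree_apply {N : ℕ} (r : Fin N → ℕ) (k : Fin N × Fin N → ℕ) (i : Fin N) :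
    totalDegree r k i = r i +
      ∑ e ∈ upperPairs N, k e * ((if e.1 = i then 1 else 0) + (if e.2 = i then 1 else 0)) := rfl

theorem sum_totalDegree {N : ℕ} (r : Fin N → ℕ) (k : Fin N × Fin N → ℕ) :
    ∑ i, totalDegree r k i = ∑ i, r i + 2 * ∑ e ∈ upperPairs N, k e := by
  simp only [totalDegree_apply, Finset.sum_add_distrib, add_right_inj]
  rw [Finset.sum_comm, Finset.mul_sum]
  refine Finset.sum_congr rfl fun e _ => ?_
  rw [← Finset.mul_sum, Finset.sum_add_distrib]
  simp [mul_comm]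

theorem prod_pow_totalDegree {N : ℕ} (r : Fin N → ℕ) (k : Fin N × Fin N → ℕ) (t : Fin N → ℝ) :
    ∏ i, t i ^ totalDegree r k i =
      (∏ i, t i ^ r i) * ∏ e ∈ upperPairs N, (t e.1 * t e.2) ^ k e := by
  simp only [totalDegree_apply, pow_add, Finset.prod_mul_distrib, ← Finset.prod_pow_eq_pow_sum]
  congr 1
  rw [Finset.prod_comm]
  refine Finset.prod_congr rfl fun e _ => ?_
  simp only [mul_add, pow_add]
  rw [Finset.prod_mul_distrib, mul_pow]
  simp only [mul_ite, mul_one, mul_zero, pow_ite, pow_zero, Finset.prod_ite_eq, Finset.mem_univ,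
    if_true]

/-- Each pair `{i, j}` containing `i` occurs once among the ordered pairs; the diagonal pair meets
`i` at both ends, whence `1 + δ_ij`. -/
theorem sum_upperPairs_symm {N : ℕ} {m : Matrix (Fin N) (Fin N) ℕ} (hm : m.IsSymm) (i : Fin N) :
    ∑ e ∈ upperPairs N, m e.1 e.2 * ((if e.1 = i then 1 else 0) + (if e.2 = i then 1 else 0)) =
      ∑ j, (1 + (if i = j then 1 else 0)) * m i j := by
  have h : ∀ a b : Fin N,
      (if a ≤ b then m a b * ((if a = i then 1 else 0) + (if b = i then 1 else 0)) else 0) =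
        (if a = i then (if a ≤ b then m a b else 0) else 0) +
          (if b = i then (if a ≤ b then m a b else 0) else 0) := by
    intro a b
    split_ifs <;> ring
  simp only [sum_upperPairs, h, Finset.sum_add_distrib]
  rw [Finset.sum_comm]
  simp only [Finset.sum_ite_eq', Finset.mem_univ, if_true]
  rw [← Finset.sum_add_distrib]
  refine Finset.sum_congr rfl fun j _ => ?_
  rw [hm.apply i j]
  rcases lt_trichotomy i j with h | h | h
  · simp [h.le, h.not_ge, h.ne]
  · simp [h]; ring
  · simp [h.le, h.not_ge, h.ne']

theorem r_eq_of_isSymm {N : ℕ} {m : Matrix (Fin N) (Fin N) ℕ} (hm : m.IsSymm) (n : Fin N → ℕ)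
    (i : Fin N) :
    r n m i = (n i : ℤ) - (∑ e ∈ upperPairs N,
      m e.1 e.2 * ((if e.1 = i then 1 else 0) + (if e.2 = i then 1 else 0)) : ℕ) := by
  rw [sum_upperPairs_symm hm, r]
  push_cast
  rfl

/-- The weight of the monomial indexed by `(r, k)`. -/
noncomputable def weight {N : ℕ} (μ : Fin N → ℝ) (q : Fin N × Fin N → ℝ) (r : Fin N → ℕ)
    (k : Fin N × Fin N → ℕ) : ℝ :=
  (∏ i, μ i ^ r i / ((r i).factorial : ℝ)) *
    ∏ e ∈ upperPairs N, q e ^ k e / ((k e).factorial : ℝ)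

/-- Restriction of a matrix to the pairs `(i, j)` with `i ≤ j`. -/
def upperPart {N : ℕ} (m : Matrix (Fin N) (Fin N) ℕ) (e : Fin N × Fin N) : ℕ :=
  if e.1 ≤ e.2 then m e.1 e.2 else 0

/-- The symmetric matrix with prescribed upper part. -/
def symmOfUpper {N : ℕ} (k : Fin N × Fin N → ℕ) : Matrix (Fin N) (Fin N) ℕ :=
  Matrix.of fun i j => k (min i j, max i j)

theorem symmOfUpper_isSymm {N : ℕ} (k : Fin N × Fin N → ℕ) : (symmOfUpper k).IsSymm :=
  Matrix.IsSymm.ext fun i j => by simp [symmOfUpper, min_comm, max_comm]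

theorem symmOfUpper_apply {N : ℕ} (k : Fin N × Fin N → ℕ) {e : Fin N × Fin N}
    (he : e.1 ≤ e.2) : symmOfUpper k e.1 e.2 = k e := by
  simp [symmOfUpper, he]

theorem symmOfUpper_upperPart {N : ℕ} {m : Matrix (Fin N) (Fin N) ℕ} (hm : m.IsSymm) :
    symmOfUpper (upperPart m) = m := by
  ext i j
  rcases le_total i j with h | h
  · simp [symmOfUpper, upperPart, h]
  · simpa [symmOfUpper, upperPart, h] using hm.apply i j

theorem upperPart_symmOfUpper {N : ℕ} {k : Fin N × Fin N → ℕ}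
    (hk : ∀ e, k e ≠ 0 → e ∈ upperPairs N) : upperPart (symmOfUpper k) = k := by
  funext e
  by_cases he : e.1 ≤ e.2
  · rw [upperPart, if_pos he, symmOfUpper_apply k he]
  · rw [upperPart, if_neg he]
    by_contra h
    exact he (mem_upperPairs.1 (hk e (Ne.symm h)))

theorem r_symmOfUpper_of_totalDegree_eq {N : ℕ} {n : Fin N → ℕ} {s : Fin N → ℕ}
    {k : Fin N × Fin N → ℕ} (h : ∀ i, totalDegree s k i = n i) (i : Fin N) :
    r n (symmOfUpper k) i = s i := by
  rw [r_eq_of_isSymm (symmOfUpper_isSymm k), ← h i, totalDegree_apply]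
  have : ∀ e ∈ upperPairs N,
      symmOfUpper k e.1 e.2 * ((if e.1 = i then 1 else 0) + (if e.2 = i then 1 else 0)) =
        k e * ((if e.1 = i then 1 else 0) + (if e.2 = i then 1 else 0)) := fun e he => by
    rw [symmOfUpper_apply k (mem_upperPairs.1 he)]
  rw [Finset.sum_congr rfl this]
  push_cast
  ring

theorem totalDegree_upperPart {N : ℕ} {n : Fin N → ℕ} {m : Matrix (Fin N) (Fin N) ℕ}
    (hm : m ∈ S n) (i : Fin N) :
    totalDegree (fun i => (r n m i).toNat) (upperPart m) i = n i := by
  have h0 := hm.2 i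
  rw [totalDegree_apply]
  have : ∀ e ∈ upperPairs N,
      upperPart m e * ((if e.1 = i then 1 else 0) + (if e.2 = i then 1 else 0)) =
        m e.1 e.2 * ((if e.1 = i then 1 else 0) + (if e.2 = i then 1 else 0)) := fun e he => by
    rw [upperPart, if_pos (mem_upperPairs.1 he)]
  rw [Finset.sum_congr rfl this]
  have h1 := r_eq_of_isSymm hm.1 n i
  omega

/-- Summing over the pairs `(s, k)` of total degree `n` is summing over `S n`. -/
theorem sum_totalDegree_eq_sum_S {N : ℕ} (n : Fin N → ℕ)
    (F : (Fin N → ℕ) → (Fin N × Fin N → ℕ) → ℝ) :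
    (∑ x ∈ weightedPairs (∑ i, n i), ∑ s ∈ Finset.piAntidiag Finset.univ x.1,
      ∑ k ∈ Finset.piAntidiag (upperPairs N) x.2,
        if totalDegree s k = Finsupp.equivFunOnFinite.symm n then F s k else 0) =
      ∑ m ∈ (S_finite n).toFinset, F (fun i => (r n m i).toNat) (upperPart m) := by
  have hdeg {s : Fin N → ℕ} {k : Fin N × Fin N → ℕ} :
      totalDegree s k = Finsupp.equivFunOnFinite.symm n ↔ ∀ i, totalDegree s k i = n i :=
    DFunLike.ext_iff
  simp only [← Finset.sum_product']
  rw [Finset.sum_sigma', ← Finset.sum_filter]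
  -- The degree condition recovers `s` from `k`. Vanishing of `k` off `upperPairs`, imposed by
  -- `piAntidiag`, makes symmetrization and restriction inverse to each other.
  refine Finset.sum_bij'
    (i := fun y _ => symmOfUpper y.2.2)
    (j := fun m _ => ⟨(∑ i, (r n m i).toNat, ∑ e ∈ upperPairs N, upperPart m e),
      (fun i => (r n m i).toNat, upperPart m)⟩) ?_ ?_ ?_ ?_ ?_
  · rintro ⟨x, s, k⟩ hy
    simp only [Finset.mem_filter, hdeg] at hy
    rw [Set.Finite.mem_toFinset]
    refine ⟨symmOfUpper_isSymm k, fun i => ?_⟩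
    rw [r_symmOfUpper_of_totalDegree_eq hy.2]
    positivity
  · intro m hm
    rw [Set.Finite.mem_toFinset] at hm
    have h := totalDegree_upperPart hm
    simp only [Finset.mem_filter, hdeg, Finset.mem_sigma, Finset.mem_product,
      Finset.mem_piAntidiag, mem_weightedPairs]
    refine ⟨⟨?_, ⟨trivial, fun _ _ => Finset.mem_univ _⟩, trivial, fun e he => ?_⟩, h⟩
    · rw [← sum_totalDegree]
      exact Finset.sum_congr rfl fun i _ => h i
    · rw [mem_upperPairs]
      by_contra hne
      exact he (if_neg hne)
  · rintro ⟨⟨a, b⟩, s, k⟩ hy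
    simp only [Finset.mem_filter, hdeg, Finset.mem_sigma, Finset.mem_product,
      Finset.mem_piAntidiag] at hy
    obtain ⟨⟨-, ⟨hs, -⟩, hk, hk'⟩, hd⟩ := hy
    simp only [r_symmOfUpper_of_totalDegree_eq hd, upperPart_symmOfUpper hk', Int.toNat_natCast,
      hs, hk]
  · intro m hm
    rw [Set.Finite.mem_toFinset] at hm
    exact symmOfUpper_upperPart hm.1
  · rintro ⟨⟨a, b⟩, s, k⟩ hy
    simp only [Finset.mem_filter, hdeg, Finset.mem_sigma, Finset.mem_product,
      Finset.mem_piAntidiag] at hy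
    obtain ⟨⟨-, ⟨hs, -⟩, hk, hk'⟩, hd⟩ := hy
    simp only [r_symmOfUpper_of_totalDegree_eq hd, upperPart_symmOfUpper hk', Int.toNat_natCast]

/-! ### Comparison of coefficients -/

theorem sum_pow_div_factorial {ι : Type*} [DecidableEq ι] (s : Finset ι) (y : ι → ℝ) (a : ℕ) :
    (∑ i ∈ s, y i) ^ a / (a.factorial : ℝ) =
      ∑ k ∈ Finset.piAntidiag s a, ∏ i ∈ s, y i ^ k i / ((k i).factorial : ℝ) := by
  rw [Finset.sum_pow_eq_sum_piAntidiag, Finset.sum_div]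
  refine Finset.sum_congr rfl fun k hk => ?_
  have h : ((∏ i ∈ s, ((k i).factorial : ℝ)) * (Nat.multinomial s k : ℝ)) = a.factorial := by
    rw [← (Finset.mem_piAntidiag.1 hk).1, ← Nat.multinomial_spec]
    push_cast
    rfl
  have h0 : (∏ i ∈ s, ((k i).factorial : ℝ)) ≠ 0 :=
    Finset.prod_ne_zero_iff.2 fun i _ => by positivity
  have h1 : (a.factorial : ℝ) ≠ 0 := by positivity
  rw [Finset.prod_div_distrib, div_eq_div_iff h1 h0, ← h]
  ring

theorem weight_mul_prod_pow {N : ℕ} (μ : Fin N → ℝ) (q : Fin N × Fin N → ℝ) (s : Fin N → ℕ)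
    (k : Fin N × Fin N → ℕ) (t : Fin N → ℝ) :
    weight μ q s k * ∏ i, t i ^ totalDegree s k i =
      (∏ i, (t i * μ i) ^ s i / ((s i).factorial : ℝ)) *
        ∏ e ∈ upperPairs N, (q e * (t e.1 * t e.2)) ^ k e / ((k e).factorial : ℝ) := by
  rw [prod_pow_totalDegree, weight, mul_mul_mul_comm, ← Finset.prod_mul_distrib,
    ← Finset.prod_mul_distrib]
  congr 1
  · exact Finset.prod_congr rfl fun i _ => by rw [mul_pow]; ring
  · exact Finset.prod_congr rfl fun e _ => by rw [mul_pow (q e)]; ring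

/-- The multinomial expansion of the coefficients of `exp (t ⬝ μ + ∑ i ≤ j, q i j * t i * t j)`. -/
theorem expQuadCoeff_eq_sum {N : ℕ} (μ : Fin N → ℝ) (q : Fin N × Fin N → ℝ) (t : Fin N → ℝ)
    (p : ℕ) :
    expQuadCoeff (∑ i, t i * μ i) (∑ e ∈ upperPairs N, q e * (t e.1 * t e.2)) p =
      ∑ x ∈ weightedPairs p, ∑ s ∈ Finset.piAntidiag Finset.univ x.1,
        ∑ k ∈ Finset.piAntidiag (upperPairs N) x.2,
          weight μ q s k * ∏ i, t i ^ totalDegree s k i := by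
  simp only [expQuadCoeff, sum_pow_div_factorial, Finset.sum_mul_sum, weight_mul_prod_pow]

/-- A family of coefficients `c` whose homogeneous generating functions are those of
`exp (t ⬝ μ + ∑ i ≤ j, q i j * t i * t j)` is given by a sum over `S n`. -/
theorem coeff_eq_sum_S {N : ℕ} (μ : Fin N → ℝ) (q : Fin N × Fin N → ℝ) (c : (Fin N → ℕ) → ℝ)
    (n : Fin N → ℕ)
    (h : ∀ t : Fin N → ℝ, ∑ k ∈ Finset.piAntidiag Finset.univ (∑ i, n i), c k * ∏ i, t i ^ k i =
      expQuadCoeff (∑ i, t i * μ i) (∑ e ∈ upperPairs N, q e * (t e.1 * t e.2)) (∑ i, n i)) :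
    c n = ∑ m ∈ (S_finite n).toFinset, weight μ q (fun i => (r n m i).toNat) (upperPart m) := by
  have hpoly : (∑ k ∈ Finset.piAntidiag Finset.univ (∑ i, n i),
        MvPolynomial.monomial (Finsupp.equivFunOnFinite.symm k) (c k) :
          MvPolynomial (Fin N) ℝ) =
      ∑ x ∈ weightedPairs (∑ i, n i), ∑ s ∈ Finset.piAntidiag Finset.univ x.1,
        ∑ k ∈ Finset.piAntidiag (upperPairs N) x.2,
          MvPolynomial.monomial (totalDegree s k) (weight μ q s k) := by
    -- Over the infinite field `ℝ`, equal values at every `t` give equal polynomials.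
    refine MvPolynomial.funext fun t => ?_
    simpa [MvPolynomial.eval_monomial, Finsupp.prod_fintype] using
      (h t).trans (expQuadCoeff_eq_sum μ q t _)
  have hcoeff := congrArg (MvPolynomial.coeff (Finsupp.equivFunOnFinite.symm n)) hpoly
  simp only [MvPolynomial.coeff_sum, MvPolynomial.coeff_monomial] at hcoeff
  rw [sum_totalDegree_eq_sum_S, Finset.sum_eq_single n] at hcoeff
  · simpa using hcoeff
  · intro k _ hk
    exact if_neg fun h => hk (Finsupp.equivFunOnFinite.symm.injective h)
  · intro hn
    simp at hn

theorem prod_factorial_mul_weight {N : ℕ} (μ : Fin N → ℝ) (C : Matrix (Fin N) (Fin N) ℝ)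
    (n : Fin N → ℕ) (m : Matrix (Fin N) (Fin N) ℕ) :
    (∏ i, ((n i).factorial : ℝ)) * weight μ (fun e => C e.1 e.2 / if e.1 = e.2 then 2 else 1)
        (fun i => (r n m i).toNat) (upperPart m) =
      d n m * (∏ i, ∏ j ∈ Finset.Ici i, C i j ^ m i j) * ∏ i, μ i ^ (r n m i).toNat := by
  have hq : ∏ e ∈ upperPairs N, (C e.1 e.2 / if e.1 = e.2 then 2 else 1) ^ upperPart m e /
        ((upperPart m e).factorial : ℝ) =
      (∏ i, ∏ j ∈ Finset.Ici i, C i j ^ m i j) /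
        ((2 : ℝ) ^ (∑ i, m i i) * ∏ i, ∏ j ∈ Finset.Ici i, ((m i j).factorial : ℝ)) := by
    -- The power of two in `d` comes from halving the diagonal entries of `C`.
    have h2 : (2 : ℝ) ^ (∑ i, m i i) =
        ∏ i, ∏ j ∈ Finset.Ici i, (if i = j then (2 : ℝ) else 1) ^ m i j := by
      rw [← Finset.prod_pow_eq_pow_sum]
      refine Finset.prod_congr rfl fun i _ => ?_
      rw [Finset.prod_eq_single i]
      · simp
      · intro j _ hj
        simp [Ne.symm hj]
      · simp
    rw [h2, prod_upperPairs]
    simp only [← Finset.prod_mul_distrib, ← Finset.prod_div_distrib]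
    refine Finset.prod_congr rfl fun i _ => Finset.prod_congr rfl fun j hj => ?_
    rw [upperPart, if_pos (Finset.mem_Ici.1 hj), div_pow, div_div]
  rw [weight, hq, d, Finset.prod_div_distrib]
  ring

theorem sum_sum_eq_two_mul_sum_upperPairs {N : ℕ} {f : Fin N → Fin N → ℝ}
    (hf : ∀ i j, f i j = f j i) :
    ∑ i, ∑ j, f i j =
      2 * ∑ e ∈ upperPairs N, f e.1 e.2 / (if e.1 = e.2 then 2 else 1) := by
  have h : ∀ i j, f i j =
      (if i ≤ j then f i j / (if i = j then 2 else 1) else 0) +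
        (if j ≤ i then f j i / (if j = i then 2 else 1) else 0) := by
    intro i j
    rcases lt_trichotomy i j with h | h | h
    · simp [h.le, h.not_ge, h.ne]
    · simp [h]
    · simp [h.le, h.not_ge, h.ne, hf i j]
  rw [sum_upperPairs, two_mul]
  -- Transposing the second copy turns it into the `j ≤ i` half of `h`.
  nth_rewrite 3 [Finset.sum_comm]
  rw [← Finset.sum_add_distrib]
  refine Finset.sum_congr rfl fun i _ => ?_
  rw [← Finset.sum_add_distrib]
  exact Finset.sum_congr rfl fun j _ => h i j

/-! ### Linear combinations of a Gaussian vector -/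

variable {Ω : Type*} [MeasurableSpace Ω] {P : Measure Ω} {N : ℕ} {X : Ω → Fin N → ℝ}

theorem integrable_prod_pow (hX : HasGaussianLaw X P) (n : Fin N → ℕ) :
    Integrable (fun ω => ∏ i, X ω i ^ n i) P := by
  have := hX.isProbabilityMeasure
  -- This power of the sup norm dominates the monomial.
  have hint : Integrable (fun ω => ‖X ω‖ ^ (∑ i, n i)) P :=
    (hX.memLp (p := ((∑ i, n i : ℕ) : ENNReal)) (by simp)).integrable_norm_pow'
  have hm : AEMeasurable X P := hX.aemeasurable
  refine hint.mono' (AEMeasurable.aestronglyMeasurable (by fun_prop)) (.of_forall fun ω => ?_)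
  rw [norm_prod, ← Finset.prod_pow_eq_pow_sum]
  refine Finset.prod_le_prod (fun i _ => norm_nonneg _) fun i _ => ?_
  rw [norm_pow]
  gcongr
  exact norm_le_pi_norm (X ω) i

theorem hasGaussianLaw_sum_mul (hX : HasGaussianLaw X P) (t : Fin N → ℝ) :
    HasGaussianLaw (fun ω => ∑ i, t i * X ω i) P := by
  simpa using hX.map_fun (∑ i, t i • (ContinuousLinearMap.proj i : (Fin N → ℝ) →L[ℝ] ℝ))

theorem memLp_two_eval (hX : HasGaussianLaw X P) (i : Fin N) : MemLp (fun ω => X ω i) 2 P :=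
  (hX.map_fun (ContinuousLinearMap.proj i : (Fin N → ℝ) →L[ℝ] ℝ)).memLp_two

theorem integral_sum_mul (hX : HasGaussianLaw X P) (t : Fin N → ℝ) :
    ∫ ω, ∑ i, t i * X ω i ∂P = ∑ i, t i * ∫ ω, X ω i ∂P := by
  have := hX.isProbabilityMeasure
  rw [integral_finsetSum _ fun i _ =>
    ((memLp_two_eval hX i).integrable one_le_two).const_mul (t i)]
  simp only [integral_const_mul]

theorem variance_sum_mul (hX : HasGaussianLaw X P) (t : Fin N → ℝ) :
    Var[fun ω => ∑ i, t i * X ω i; P] =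
      ∑ i, ∑ j, cov[fun ω => X ω i, fun ω => X ω j; P] * (t i * t j) := by
  have := hX.isProbabilityMeasure
  have h (i : Fin N) : MemLp (fun ω => t i * X ω i) 2 P := (memLp_two_eval hX i).const_mul (t i)
  rw [← covariance_self (hasGaussianLaw_sum_mul hX t).aemeasurable,
    covariance_fun_sum_fun_sum h h]
  refine Finset.sum_congr rfl fun i _ => Finset.sum_congr rfl fun j _ => ?_
  rw [covariance_const_mul_left, covariance_const_mul_right]
  ring

/-- Both sides are `E[(∑ t_i X_i) ^ p] / p!`: one by the multinomial theorem, the other by the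
one-dimensional formula. -/
theorem sum_moments_eq_expQuadCoeff (hX : HasGaussianLaw X P) (t : Fin N → ℝ) (p : ℕ) :
    ∑ k ∈ Finset.piAntidiag Finset.univ p,
        ((∫ ω, ∏ i, X ω i ^ k i ∂P) / ∏ i, ((k i).factorial : ℝ)) * ∏ i, t i ^ k i =
      expQuadCoeff (∑ i, t i * ∫ ω, X ω i ∂P)
        (∑ e ∈ upperPairs N, cov[fun ω => X ω e.1, fun ω => X ω e.2; P] /
          (if e.1 = e.2 then 2 else 1) * (t e.1 * t e.2)) p := by
  have hvar : Var[fun ω => ∑ i, t i * X ω i; P] / 2 =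
      ∑ e ∈ upperPairs N, cov[fun ω => X ω e.1, fun ω => X ω e.2; P] /
          (if e.1 = e.2 then 2 else 1) * (t e.1 * t e.2) := by
    rw [variance_sum_mul hX, sum_sum_eq_two_mul_sum_upperPairs fun i j => by
      rw [covariance_comm, mul_comm (t i)], mul_div_cancel_left₀ _ two_ne_zero]
    exact Finset.sum_congr rfl fun e _ => by rw [div_mul_eq_mul_div]
  have hp : (p.factorial : ℝ) ≠ 0 := by positivity
  have hmom := integral_pow_of_hasGaussianLaw (hasGaussianLaw_sum_mul hX t) p
  rw [integral_sum_mul hX, hvar] at hmom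
  rw [← mul_right_inj' hp, ← hmom, mul_comm, ← eq_div_iff hp, ← integral_div]
  simp only [sum_pow_div_factorial]
  have hterm (k : Fin N → ℕ) (ω : Ω) :
      ∏ i, (t i * X ω i) ^ k i / ((k i).factorial : ℝ) =
        (∏ i, X ω i ^ k i) * ((∏ i, t i ^ k i) / ∏ i, ((k i).factorial : ℝ)) := by
    simp only [mul_pow, Finset.prod_div_distrib, Finset.prod_mul_distrib]
    ring
  simp only [hterm]
  rw [integral_finsetSum _ fun k _ => (integrable_prod_pow hX k).mul_const _]
  refine Finset.sum_congr rfl fun k _ => ?_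
  rw [integral_mul_const]
  ring

end GaussianMoments

theorem mainTheorem3 {Ω : Type*} [MeasurableSpace Ω] (P : Measure Ω) {N : ℕ}
    (X : Ω → Fin N → ℝ) (hX : HasGaussianLaw X P)
    (μ : Fin N → ℝ) (hμ : ∀ i, μ i = ∫ ω, X ω i ∂P)
    (C : Matrix (Fin N) (Fin N) ℝ)
    (hC : ∀ i j, C i j = cov[fun ω => X ω i, fun ω => X ω j; P])
    (n : Fin N → ℕ) :
    Integrable (fun ω => ∏ i, X ω i ^ n i) P ∧
      ∫ ω, ∏ i, X ω i ^ n i ∂P =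
        ∑ m ∈ (GaussianMoments.S_finite n).toFinset,
          GaussianMoments.d n m * (∏ i, ∏ j ∈ Finset.Ici i, C i j ^ m i j) *
            ∏ i, μ i ^ (GaussianMoments.r n m i).toNat := by
  refine ⟨GaussianMoments.integrable_prod_pow hX n, ?_⟩
  have h := GaussianMoments.coeff_eq_sum_S μ (fun e => C e.1 e.2 / if e.1 = e.2 then 2 else 1)
    (fun k => (∫ ω, ∏ i, X ω i ^ k i ∂P) / ∏ i, ((k i).factorial : ℝ)) n fun t => by
      simp only [hμ, hC]
      exact GaussianMoments.sum_moments_eq_expQuadCoeff hX t _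
  have h0 : (∏ i, ((n i).factorial : ℝ)) ≠ 0 :=
    Finset.prod_ne_zero_iff.2 fun i _ => by positivity
  rw [div_eq_iff h0, mul_comm, Finset.mul_sum] at h
  rw [h]
  exact Finset.sum_congr rfl fun m _ => GaussianMoments.prod_factorial_mul_weight μ C n m
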